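/- For positive integers $k$, $w$, $t$, a $(k,wt;w)$-cyclic holey difference matrix, briefly a $(k,wt;w)$-CHDM, is a $k\times w(t-1)$ matrix $D=(d_{ij})$ with entries from $\mathbb{Z}_{wt}$ such that for any two distinct rows $x$ and $y$ the list of differences $\{d_{xj}-d_{yj} : 1\le j\le w(t-1)\}$ contains each element of $\mathbb{Z}_{wt}\setminus S$ exactly once and contains no element of $S$, where $S=\{0,t,\ldots,(w-1)t\}$ is the subgroup of order $w$ in $\mathbb{Z}_{wt}$. **Lemma.** There exists a $(3,2^xt;2^x)$-CHDM for any integers $x\ge 3$ and $t\ge 5$. -/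

import Mathlib

/-- The subset `S = {0, t, 2t, …, (w-1)t}` of `ℤ/(wt)ℤ`; for `w, t ≥ 1` it is the subgroup of
order `w`. -/
def holeSet (w t : ℕ) : Set (ZMod (w * t)) :=
  {d | ∃ i : ℕ, i < w ∧ d = ((i * t : ℕ) : ZMod (w * t))}

/-- `D` is a `(k, wt; w)`-cyclic holey difference matrix: a `k × w(t-1)` matrix over `ℤ/(wt)ℤ` such
that, for any two distinct rows `x` and `y`, the list of differences `D x j - D y j` contains each
element outside `holeSet w t` exactly once, and no element of `holeSet w t`. -/
def IsCHDM (k w t : ℕ) (D : Matrix (Fin k) (Fin (w * (t - 1))) (ZMod (w * t))) : Prop :=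
  ∀ x y : Fin k, x ≠ y →
    (∀ d : ZMod (w * t), d ∉ holeSet w t → ∃! j, D x j - D y j = d) ∧
    (∀ d : ZMod (w * t), d ∈ holeSet w t → ∀ j, D x j - D y j ≠ d)

/-! The columns of the matrix are indexed by `(d, i)` with `0 < |d| < t` and `0 ≤ i < m`, where
`w = 2 * m` and `m` is even. Every `d` is written as a difference `a d - b d` of elements of
`[0, t) \ {g}`, each of which is used twice as a minuend and twice as a subtrahend; `c d` and `c' d`
in `{0, 1}` tell the two uses apart. The rows are `a d - g + t * (i + m * c d)`, `0` and
`b d - g - t * (i + m * c' d)`. The first row takes each residue off the hole once, since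
`i + m * c d` runs over `[0, 2 * m)` for each value of `a d`; so does the third. Their difference
is `d + t * (2 * i + m * (c d + c' d))`: as `m` is even, `d` is determined modulo `2 * t`, and then
`i` modulo `m`. -/

section Hole

variable {w t : ℕ}

theorem holeSet_eq_zmultiples (hw : 0 < w) :
    holeSet w t = (AddSubgroup.zmultiples (t : ZMod (w * t)) : Set (ZMod (w * t))) := by
  ext d
  constructor
  · rintro ⟨i, -, rfl⟩
    exact ⟨i, by simp⟩
  · rintro ⟨q, rfl⟩
    have hw' : (w : ℤ) ≠ 0 := by omega
    refine ⟨(q % w).toNat, by have := Int.emod_lt_of_pos q (b := w); omega, ?_⟩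
    suffices q * t ≡ q % w * t [ZMOD w * t] by
      simpa [Int.emod_nonneg q hw'] using
        (ZMod.intCast_eq_intCast_iff (q * t) (q % w * t) (w * t)).2 (mod_cast this)
    exact (Int.mod_modEq q w).symm.mul_right'

theorem intCast_mem_holeSet_iff (hw : 0 < w) {z : ℤ} :
    (z : ZMod (w * t)) ∈ holeSet w t ↔ (t : ℤ) ∣ z := by
  rw [holeSet_eq_zmultiples hw, SetLike.mem_coe, AddSubgroup.mem_zmultiples_iff]
  constructor
  · rintro ⟨q, hq⟩
    have h : q * t ≡ z [ZMOD (w * t : ℕ)] :=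
      (ZMod.intCast_eq_intCast_iff _ _ _).1 (by simpa using hq)
    push_cast at h
    exact (h.of_mul_left w).dvd_iff.1 (dvd_mul_left _ _)
  · rintro ⟨q, rfl⟩
    exact ⟨q, by simp [mul_comm]⟩

theorem ncard_compl_holeSet (hw : 0 < w) (ht : 0 < t) : (holeSet w t)ᶜ.ncard = w * (t - 1) := by
  have : NeZero (w * t) := ⟨by positivity⟩
  have hcard : (holeSet w t).ncard = w := by
    rw [holeSet_eq_zmultiples hw, ← Nat.card_coe_set_eq, SetLike.coe_sort_coe, Nat.card_zmultiples,
      ZMod.addOrderOf_coe t (by positivity), Nat.gcd_mul_left_left, Nat.mul_div_cancel w ht]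
  rw [Set.ncard_compl, hcard, Nat.card_zmod, Nat.mul_sub_one]

variable {α : Type*} {s : Finset α}

theorem bijOn_intCast_compl_holeSet (hw : 0 < w) (ht : 0 < t) (hs : s.card = w * (t - 1))
    {f : α → ℤ} (hinj : ∀ p ∈ s, ∀ q ∈ s, f p ≡ f q [ZMOD w * t] → p = q)
    (hdvd : ∀ p ∈ s, ¬(t : ℤ) ∣ f p) :
    Set.BijOn (fun p ↦ (f p : ZMod (w * t))) s (holeSet w t)ᶜ := by
  have : NeZero (w * t) := ⟨by positivity⟩
  have hmaps : Set.MapsTo (fun p ↦ (f p : ZMod (w * t))) s (holeSet w t)ᶜ :=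
    fun p hp hmem ↦ hdvd p hp ((intCast_mem_holeSet_iff hw).1 hmem)
  have hinjOn : Set.InjOn (fun p ↦ (f p : ZMod (w * t))) s := fun p hp q hq hpq ↦
    hinj p hp q hq (mod_cast (ZMod.intCast_eq_intCast_iff _ _ _).1 hpq)
  refine ⟨hmaps, hinjOn, (Set.eq_of_subset_of_ncard_le hmaps.image_subset ?_).ge⟩
  rw [ncard_compl_holeSet hw ht, hinjOn.ncard_image, Set.ncard_coe_finset, hs]

theorem bijOn_neg_compl_holeSet (hw : 0 < w) {f : α → ZMod (w * t)} {s : Set α}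
    (hf : Set.BijOn f s (holeSet w t)ᶜ) :
    Set.BijOn (fun p ↦ -f p) s (holeSet w t)ᶜ := by
  refine Set.BijOn.comp (t := (holeSet w t)ᶜ) (g := Neg.neg) ?_ hf
  have hneg : Set.MapsTo Neg.neg (holeSet w t)ᶜ (holeSet w t)ᶜ := by
    simp [Set.MapsTo, holeSet_eq_zmultiples hw]
  exact Set.InvOn.bijOn ⟨fun _ _ ↦ neg_neg _, fun _ _ ↦ neg_neg _⟩ hneg hneg

theorem exists_isCHDM_of_bijOn (hw : 0 < w) (hs : s.card = w * (t - 1)) {k : ℕ}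
    (R : Fin k → α → ZMod (w * t))
    (hR : ∀ x y, x < y → Set.BijOn (fun p ↦ R x p - R y p) s (holeSet w t)ᶜ) :
    ∃ D : Matrix (Fin k) (Fin (w * (t - 1))) (ZMod (w * t)), IsCHDM k w t D := by
  have hR' : ∀ x y, x ≠ y → Set.BijOn (fun p ↦ R x p - R y p) s (holeSet w t)ᶜ := by
    intro x y hxy
    rcases hxy.lt_or_gt with hlt | hgt
    · exact hR x y hlt
    · simpa only [neg_sub] using bijOn_neg_compl_holeSet hw (hR y x hgt)
  let e := (s.equivFinOfCardEq hs).symm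
  refine ⟨fun x j ↦ R x (e j), fun x y hxy ↦ ⟨fun d hd ↦ ?_, ?_⟩⟩
  · obtain ⟨p, hp, rfl⟩ := (hR' x y hxy).surjOn hd
    refine ⟨e.symm ⟨p, hp⟩, by simp, fun j hj ↦ e.injective (Subtype.ext ?_)⟩
    simpa using (hR' x y hxy).injOn (e j).2 hp hj
  · rintro _ hd j rfl
    exact (hR' x y hxy).mapsTo (e j).2 hd

theorem exists_isCHDM_three_of_bijOn (hw : 0 < w) (hs : s.card = w * (t - 1))
    {A B : α → ZMod (w * t)} (hA : Set.BijOn A s (holeSet w t)ᶜ)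
    (hB : Set.BijOn B s (holeSet w t)ᶜ) (hAB : Set.BijOn (fun p ↦ A p + B p) s (holeSet w t)ᶜ) :
    ∃ D : Matrix (Fin 3) (Fin (w * (t - 1))) (ZMod (w * t)), IsCHDM 3 w t D := by
  refine exists_isCHDM_of_bijOn hw hs ![A, 0, -B] fun x y hxy ↦ ?_
  fin_cases x <;> fin_cases y <;> first | exact absurd hxy (by decide) | simpa

end Hole

section Columns

theorem eq_of_modEq_of_abs_sub_lt {n a b : ℤ} (h : a ≡ b [ZMOD n]) (hlt : |a - b| < n) : a = b :=
  sub_eq_zero.1 (Int.eq_zero_of_abs_lt_dvd h.symm.dvd hlt)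

theorem eq_and_modEq_of_add_mul_modEq {T W a b p q : ℤ} (hab : |a - b| < T)
    (h : a + T * p ≡ b + T * q [ZMOD T * W]) : a = b ∧ p ≡ q [ZMOD W] := by
  have hT : T ≠ 0 := ((abs_nonneg _).trans_lt hab).ne'
  obtain rfl : a = b := eq_of_modEq_of_abs_sub_lt (by simpa using h.of_mul_right W) hab
  exact ⟨rfl, (h.add_left_cancel' a).mul_left_cancel' hT⟩

/-- The nonzero differences of elements of `[0, t)`. -/
noncomputable def nonzeroDifferences (t : ℤ) : Finset ℤ := (Finset.Ioo (-t) t).erase 0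

theorem mem_nonzeroDifferences {t d : ℤ} :
    d ∈ nonzeroDifferences t ↔ d ≠ 0 ∧ -t < d ∧ d < t := by
  simp only [nonzeroDifferences, Finset.mem_erase, Finset.mem_Ioo]

/-- The index set of the columns of a difference matrix with hole of order `2 * m`: each nonzero
difference is repeated `m` times. -/
noncomputable def columnIndices (m t : ℕ) : Finset (ℤ × ℤ) :=
  nonzeroDifferences t ×ˢ Finset.Ico 0 (m : ℤ)

theorem mem_columnIndices {m t : ℕ} {p : ℤ × ℤ} :
    p ∈ columnIndices m t ↔ p.1 ∈ nonzeroDifferences t ∧ 0 ≤ p.2 ∧ p.2 < m := by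
  simp only [columnIndices, Finset.mem_product, Finset.mem_Ico]

theorem card_columnIndices {m t : ℕ} (ht : 0 < t) :
    (columnIndices m t).card = 2 * m * (t - 1) := by
  have hmem : (0 : ℤ) ∈ Finset.Ioo (-(t : ℤ)) t := by simpa
  have hcard : (nonzeroDifferences t).card = 2 * (t - 1) := by
    rw [nonzeroDifferences, Finset.card_erase_of_mem hmem, Int.card_Ioo]
    omega
  rw [columnIndices, Finset.card_product, hcard, Int.card_Ico, sub_zero, Int.toNat_natCast]
  ring

theorem bijOn_add_mul_compl_holeSet {m t : ℕ} (hm : 0 < m) (hm2 : Even m) (ht : 0 < t)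
    (s : ℤ → ℤ) :
    Set.BijOn (fun p : ℤ × ℤ ↦ ((p.1 + t * (2 * p.2 + m * s p.1) : ℤ) : ZMod (2 * m * t)))
      (columnIndices m t) (holeSet (2 * m) t)ᶜ := by
  refine bijOn_intCast_compl_holeSet (by omega) ht (card_columnIndices ht) ?_ ?_
  · rintro ⟨d, i⟩ hp ⟨e, j⟩ hq h
    simp only [mem_columnIndices, mem_nonzeroDifferences] at hp hq
    obtain ⟨n, rfl⟩ := hm2
    have h' : d + 2 * t * (i + n * s d) ≡ e + 2 * t * (j + n * s e)
        [ZMOD 2 * t * (n + n : ℕ)] := by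
      convert h using 1 <;> push_cast <;> ring
    obtain ⟨rfl, hij⟩ := eq_and_modEq_of_add_mul_modEq (by rw [abs_lt]; omega) h'
    rw [eq_of_modEq_of_abs_sub_lt (hij.add_right_cancel' _) (by rw [abs_lt]; omega)]
  · rintro ⟨d, i⟩ hp hdvd
    simp only [mem_columnIndices, mem_nonzeroDifferences] at hp
    have hd : (t : ℤ) ∣ d := (dvd_add_left (dvd_mul_right _ _)).1 hdvd
    exact hp.1.1 (Int.eq_zero_of_abs_lt_dvd hd (abs_lt.2 hp.1.2))

end Columns

section Labelling

/-- `u` labels the nonzero differences by elements of `[0, t)` other than `g`, using each element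
at most twice; the two uses are told apart by the colour `c ∈ {0, 1}`. -/
structure IsTwofoldLabelling (t g : ℤ) (u c : ℤ → ℤ) : Prop where
  gap_nonneg : 0 ≤ g
  gap_lt : g < t
  nonneg : ∀ d ∈ nonzeroDifferences t, 0 ≤ u d
  lt : ∀ d ∈ nonzeroDifferences t, u d < t
  ne_gap : ∀ d ∈ nonzeroDifferences t, u d ≠ g
  colour_nonneg : ∀ d ∈ nonzeroDifferences t, 0 ≤ c d
  colour_lt : ∀ d ∈ nonzeroDifferences t, c d < 2
  inj : ∀ d ∈ nonzeroDifferences t, ∀ e ∈ nonzeroDifferences t, u d = u e → c d = c e → d = e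

theorem IsTwofoldLabelling.reflect {t g : ℤ} {u c : ℤ → ℤ} (h : IsTwofoldLabelling t g u c) :
    IsTwofoldLabelling t (t - 1 - g) (fun d ↦ t - 1 - u d) c where
  gap_nonneg := by linarith [Int.add_one_le_of_lt h.gap_lt]
  gap_lt := by linarith [h.gap_nonneg]
  nonneg d hd := by linarith [Int.add_one_le_of_lt (h.lt d hd)]
  lt d hd := by linarith [h.nonneg d hd]
  ne_gap d hd := by simpa using h.ne_gap d hd
  colour_nonneg := h.colour_nonneg
  colour_lt := h.colour_lt
  inj d hd e he hu := h.inj d hd e he (by simpa using hu)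

theorem IsTwofoldLabelling.bijOn {m t : ℕ} {g : ℤ} {u c : ℤ → ℤ} (hm : 0 < m)
    (h : IsTwofoldLabelling t g u c) :
    Set.BijOn (fun p : ℤ × ℤ ↦ ((u p.1 - g + t * (p.2 + m * c p.1) : ℤ) : ZMod (2 * m * t)))
      (columnIndices m t) (holeSet (2 * m) t)ᶜ := by
  have ht : 0 < t := mod_cast h.gap_nonneg.trans_lt h.gap_lt
  refine bijOn_intCast_compl_holeSet (by omega) ht (card_columnIndices ht) ?_ ?_
  · rintro ⟨d, i⟩ hp ⟨e, j⟩ hq hmod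
    obtain ⟨hd, hi⟩ := mem_columnIndices.1 hp
    obtain ⟨he, hj⟩ := mem_columnIndices.1 hq
    have hmod' : u d - g + t * (i + m * c d) ≡ u e - g + t * (j + m * c e) [ZMOD t * (m * 2)] := by
      convert hmod using 1
      push_cast
      ring
    have hlt : |(u d - g) - (u e - g)| < t := by
      rw [sub_sub_sub_cancel_right]
      exact abs_sub_lt_of_nonneg_of_lt (h.nonneg d hd) (h.lt d hd) (h.nonneg e he) (h.lt e he)
    obtain ⟨hu, hlevel⟩ := eq_and_modEq_of_add_mul_modEq hlt hmod'
    obtain ⟨hij, hcolour⟩ := eq_and_modEq_of_add_mul_modEq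
      (abs_sub_lt_of_nonneg_of_lt hi.1 hi.2 hj.1 hj.2) hlevel
    have hc : c d = c e := eq_of_modEq_of_abs_sub_lt hcolour
      (abs_sub_lt_of_nonneg_of_lt (h.colour_nonneg d hd) (h.colour_lt d hd) (h.colour_nonneg e he)
        (h.colour_lt e he))
    exact Prod.ext (h.inj d hd e he (sub_left_inj.1 hu) hc) hij
  · rintro ⟨d, i⟩ hp hdvd
    have hd := (mem_columnIndices.1 hp).1
    have hug : (t : ℤ) ∣ u d - g := (dvd_add_left (dvd_mul_right _ _)).1 hdvd
    have hlt := abs_sub_lt_of_nonneg_of_lt (h.nonneg d hd) (h.lt d hd) h.gap_nonneg h.gap_lt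
    exact h.ne_gap d hd (sub_eq_zero.1 (Int.eq_zero_of_abs_lt_dvd hug hlt))

/-- Each nonzero difference `d` of elements of `[0, t)` is written as `a d - (a d - d)` with both
terms in `[0, t) \ {g}`, so that each element is at most twice a minuend and at most twice a
subtrahend: a variant of a graceful labelling for 2-regular directed graphs. The colours `c` and
`c'` tell the two uses apart. -/
structure IsGracefulLabelling (t g : ℤ) (a c c' : ℤ → ℤ) : Prop where
  minuend : IsTwofoldLabelling t g a c
  subtrahend : IsTwofoldLabelling t g (fun d ↦ a d - d) c'

theorem IsGracefulLabelling.exists_isCHDM {m t : ℕ} {g : ℤ} {a c c' : ℤ → ℤ}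
    (h : IsGracefulLabelling t g a c c') (hm : 0 < m) (hm2 : Even m) :
    ∃ D : Matrix (Fin 3) (Fin (2 * m * (t - 1))) (ZMod (2 * m * t)), IsCHDM 3 (2 * m) t D := by
  have ht : 0 < t := mod_cast h.minuend.gap_nonneg.trans_lt h.minuend.gap_lt
  refine exists_isCHDM_three_of_bijOn (by omega) (card_columnIndices ht) (h.minuend.bijOn hm)
    (h.subtrahend.reflect.bijOn hm) ?_
  convert bijOn_add_mul_compl_holeSet hm hm2 ht (fun d ↦ c d + c' d) using 2 with p
  rw [← Int.cast_add]
  congr 1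
  ring

/- In the labellings below, `d` is attached to the pair `(s + d) / 2`, `(s - d) / 2` of sum `s`.
Where `s` is constant the labels are distinct, and the colours separate the ranges of `d` whose
labels overlap. -/

theorem exists_gracefulLabelling_four_mul_add_one (k : ℤ) (hk : 0 ≤ k) :
    ∃ g a c c', IsGracefulLabelling (4 * k + 1) g a c c' := by
  let sumColour (d : ℤ) : ℤ × ℤ :=
    if d = 2 * k ∨ d = -2 * k then (6 * k, 1)
    else if -2 * k < d ∧ d < 2 * k then
      if d % 2 = 0 then (4 * k, 1) else (4 * k + 1, 0)
    else if d % 2 = 0 then (4 * k, 0) else (4 * k - 1, 1)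
  refine ⟨k, fun d ↦ ((sumColour d).1 + d) / 2, fun d ↦ (sumColour d).2,
    fun d ↦ (sumColour d).2, ?_, ?_⟩ <;>
  constructor <;> grind (splits := 20) [mem_nonzeroDifferences]

theorem exists_gracefulLabelling_four_mul_add_three (k : ℤ) (hk : 1 ≤ k) :
    ∃ g a c c', IsGracefulLabelling (4 * k + 3) g a c c' := by
  let sumColours (d : ℤ) : ℤ × ℤ × ℤ :=
    if d = 2 * k then (6 * k + 4, 1, 0)
    else if d = 1 - 2 * k then (4 * k + 3, 0, 1)
    else if d = -2 * k then (4 * k, 1, 1)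
    else if d = -2 * k - 1 then (6 * k + 3, 1, 1)
    else if d < -2 * k ∨ 2 * k < d then
      if d % 2 = 0 then (4 * k + 2, 0, 0) else (4 * k + 1, 1, 1)
    else if 0 < d then
      if d % 2 = 0 then (4 * k + 2, 1, 1) else (4 * k + 3, 0, 0)
    else if d % 2 = 0 then (4 * k + 4, 0, 0) else (4 * k + 1, 1, 1)
  refine ⟨k + 1, fun d ↦ ((sumColours d).1 + d) / 2, fun d ↦ (sumColours d).2.1,
    fun d ↦ (sumColours d).2.2, ?_, ?_⟩ <;>
  constructor <;> grind (splits := 20) [mem_nonzeroDifferences]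

theorem exists_gracefulLabelling_two_mul (k : ℤ) (hk : 2 ≤ k) :
    ∃ g a c c', IsGracefulLabelling (2 * k) g a c c' := by
  let sumColours (d : ℤ) : ℤ × ℤ × ℤ :=
    if d = 2 * k - 1 then (2 * k - 1, 0, 1)
    else if d = 2 then (2 * k, 1, 0)
    else if d = 1 then (2 * k - 3, 0, 0)
    else if d = -1 then (1, 1, 1)
    else if 0 < d then
      if d % 2 = 0 then (2 * k - 2, 0, 0) else (2 * k + 1, 1, 1)
    else if d % 2 = 0 then (2 * k, 1, 1) else (2 * k - 1, 0, 0)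
  refine ⟨k, fun d ↦ ((sumColours d).1 + d) / 2, fun d ↦ (sumColours d).2.1,
    fun d ↦ (sumColours d).2.2, ?_, ?_⟩ <;>
  constructor <;> grind (splits := 20) [mem_nonzeroDifferences]

theorem exists_gracefulLabelling (t : ℤ) (ht : 4 ≤ t) :
    ∃ g a c c', IsGracefulLabelling t g a c c' := by
  obtain h | h | h : t = 4 * (t / 4) + 1 ∨ t = 4 * (t / 4) + 3 ∨ t = 2 * (t / 2) := by omega
  · exact h ▸ exists_gracefulLabelling_four_mul_add_one (t / 4) (by omega)
  · exact h ▸ exists_gracefulLabelling_four_mul_add_three (t / 4) (by omega)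
  · exact h ▸ exists_gracefulLabelling_two_mul (t / 2) (by omega)

end Labelling

theorem lemma5p3_general (w t : ℕ) (hw : 0 < w) (hw4 : 4 ∣ w) (ht : 4 ≤ t) :
    ∃ D : Matrix (Fin 3) (Fin (w * (t - 1))) (ZMod (w * t)), IsCHDM 3 w t D := by
  obtain ⟨g, a, c, c', h⟩ := exists_gracefulLabelling t (by exact_mod_cast ht)
  obtain ⟨m, rfl⟩ : 2 ∣ w := Dvd.dvd.trans (by decide) hw4
  exact h.exists_isCHDM (by omega) (even_iff_two_dvd.2 (by omega))

theorem lemma5p3 (x t : ℕ) (hx : 3 ≤ x) (ht : 5 ≤ t) :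
    ∃ D : Matrix (Fin 3) (Fin (2 ^ x * (t - 1))) (ZMod (2 ^ x * t)), IsCHDM 3 (2 ^ x) t D :=
  lemma5p3_general (2 ^ x) t (by positivity) (pow_dvd_pow 2 (by omega : 2 ≤ x)) (by omega)
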